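/- Let $G\rightrightarrows M$ be a Lie groupoid with $M$ compact, source and target maps $\mathbf s,\mathbf t:G\to M$ (submersions), unit map $\mathbf u:M\to G$, Lie algebroid $A=\ker(d\mathbf s)|_{\mathbf u(M)}\to M$ and anchor $\nu=d\mathbf t|_A:A\to TM$. Assume that $G$ is a boundary groupoid, with connected leaves and isotropy groups, that is: 1. the singular foliation of $M$ defined by $\nu$ has finitely many leaves $M_0,\dots,M_r$, where $\dim M=\dim M_0>\dim M_1>\dots>\dim M_r$; 2. each $\bar M_k:=M_k\cup M_{k+1}\cup\dots\cup M_r$ is a closed immersed submanifold of $M$; 3. $\mathbf s^{-1}(M_k)=\mathbf t^{-1}(M_k)$, and this Lie groupoid over $M_k$ is isomorphic to $G_k\times(M_k\times M_k)$ for some connected Lie group $G_k$, with $G_0$ trivial; 4. for each $k$ there is a subbundle $\bar A_k\subset A|_{\bar M_k}$ with $\bar A_k|_{M_k}=\ker(\nu|_{M_k})$. Fix a smooth metric $g_A$ on $A$. By right invariance it induces a Riemannian metric on every $\mathbf s$-fiber $G_x=\mathbf s^{-1}(x)$; let $d$ be the corresponding distance on $G_x$. Fix a Riemannian metric $\bar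 g$ on $M$ and $k\in\{0,\dots,r\}$, and let $\rho_k:M\to\mathbb R$ be a function that is smooth and positive on $M\setminus\bar M_k$ and equal to the $\bar g$-distance to $\bar M_k$ on some open set containing $\bar M_k$. Let $\omega_k\in\mathbb R$ be a constant such that $$|d\rho_k(\nu(X))|\le\omega_k\,\rho_k(x)\,|X|_{g_A}\qquad\text{for all }x\in M\setminus\bar M_k,\ X\in A_x .$$ Then for every $x\in M$ and all $a,b\in G_x$ the distance $d(a,b)$ is finite, and: * if $x\notin\bar M_k$, then $\rho_k(\mathbf t(a))>0$, $\rho_k(\mathbf t(b))>0$ and $$\omega_k\,d(a,b)\ \ge\ \left|\log\left(\frac{\rho_k(\mathbf t(b))}{\rho_k(\mathbf t(a))}\right)\right| ;$$ * if $x\in\bar M_k$, then $\rho_k(\mathbf t(a))=\rho_k(\mathbf t(b))=0$ (so that the quotient is not defined). -/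

import Mathlib

open Set MeasureTheory Bundle
open scoped Manifold ContDiff ENNReal Topology

noncomputable section

universe uE uH uM uF uK uG

/-- A Lie groupoid `G ⇉ M`.  The multiplication is a total function of which only the values on
composable pairs (`src a = tgt b`) are meaningful; all axioms, and the smoothness (on the embedded
submanifold of composable pairs), only concern these values. -/
structure LieGroupoid
    {E : Type uE} [NormedAddCommGroup E] [NormedSpace ℝ E]
    {H : Type uH} [TopologicalSpace H] (I : ModelWithCorners ℝ E H)
    (M : Type uM) [TopologicalSpace M] [ChartedSpace H M]
    {F : Type uF} [NormedAddCommGroup F] [NormedSpace ℝ F]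
    {K : Type uK} [TopologicalSpace K] (J : ModelWithCorners ℝ F K)
    (G : Type uG) [TopologicalSpace G] [ChartedSpace K G] where
  unit : M → G
  src : G → M
  tgt : G → M
  mul : G → G → G
  inv : G → G
  contMDiff_unit : ContMDiff I J ∞ unit
  isSubmersion_src : Manifold.IsSubmersion J I ∞ src
  isSubmersion_tgt : Manifold.IsSubmersion J I ∞ tgt
  contMDiffOn_mul : ContMDiffOn (J.prod J) J ∞ (fun p : G × G => mul p.1 p.2)
    {p : G × G | src p.1 = tgt p.2}
  contMDiff_inv : ContMDiff J J ∞ inv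
  src_unit : ∀ x, src (unit x) = x
  tgt_unit : ∀ x, tgt (unit x) = x
  src_mul : ∀ a b, src a = tgt b → src (mul a b) = src b
  tgt_mul : ∀ a b, src a = tgt b → tgt (mul a b) = tgt a
  mul_assoc : ∀ a b c, src a = tgt b → src b = tgt c → mul (mul a b) c = mul a (mul b c)
  mul_unit : ∀ a, mul a (unit (src a)) = a
  unit_mul : ∀ a, mul (unit (tgt a)) a = a
  src_inv : ∀ a, src (inv a) = tgt a
  tgt_inv : ∀ a, tgt (inv a) = src a
  mul_inv : ∀ a, mul a (inv a) = unit (tgt a)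
  inv_mul : ∀ a, mul (inv a) a = unit (src a)

namespace LieGroupoid

variable {E : Type uE} [NormedAddCommGroup E] [NormedSpace ℝ E]
  {H : Type uH} [TopologicalSpace H] {I : ModelWithCorners ℝ E H}
  {M : Type uM} [TopologicalSpace M] [ChartedSpace H M]
  {F : Type uF} [NormedAddCommGroup F] [NormedSpace ℝ F]
  {K : Type uK} [TopologicalSpace K] {J : ModelWithCorners ℝ F K}
  {G : Type uG} [TopologicalSpace G] [ChartedSpace K G]

/-- The fibre `A_x = ker (d src)` at the unit `unit x` of the Lie algebroid `A` of the groupoid. -/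
def algebroidFiber (𝓖 : LieGroupoid I M J G) (x : M) :
    Submodule ℝ (TangentSpace J (𝓖.unit x)) :=
  LinearMap.ker (mfderiv J I 𝓖.src (𝓖.unit x)).toLinearMap

/-- The total space of the Lie algebroid, as a subset of `TG`. -/
def algebroid (𝓖 : LieGroupoid I M J G) : Set (TangentBundle J G) :=
  {v | ∃ x : M, ∃ X ∈ 𝓖.algebroidFiber x, v = ⟨𝓖.unit x, X⟩}

/-- The anchor `ν = d tgt` on `A_x`.  (The derivative takes values in the tangent space at
`tgt (unit x)`, and `tgt (unit x) = x`.) -/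
def anchor (𝓖 : LieGroupoid I M J G) (x : M) :
    TangentSpace J (𝓖.unit x) →L[ℝ] TangentSpace I x :=
  (mfderiv J I 𝓖.tgt (𝓖.unit x) : F →L[ℝ] E)

/-- `y` lies in the leaf through `x` of the singular foliation defined by the anchor: the two points
are joined by a `C¹` curve in `M` whose velocity is the image under the anchor of a continuous curve
in the Lie algebroid lying over it. -/
def SameLeaf [IsManifold J ∞ G] (𝓖 : LieGroupoid I M J G) (x y : M) : Prop :=
  ∃ (γ : ℝ → M) (α : ℝ → TangentBundle J G),
    γ 0 = x ∧ γ 1 = y ∧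
    ContMDiffOn 𝓘(ℝ, ℝ) I 1 γ (Icc 0 1) ∧
    ContinuousOn α (Icc 0 1) ∧
    ∀ τ ∈ Icc (0 : ℝ) 1, α τ ∈ 𝓖.algebroid ∧
      tangentMapWithin 𝓘(ℝ, ℝ) I γ (Icc 0 1) ⟨τ, (1 : ℝ)⟩ = tangentMap J I 𝓖.tgt (α τ)

/-- A smooth metric `g_A` on the Lie algebroid `A ⊆ TG`: a scalar product on each `A_x ⊆ T_{unit x} G`
such that `v ↦ g_A(v, v)` is smooth on the total space of `A`.  It is recorded by a family of
bilinear forms on the tangent spaces of `G`, of which only the restrictions to the `A_x` matter. -/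
structure AlgebroidMetric [IsManifold J ∞ G] (𝓖 : LieGroupoid I M J G) where
  form : ∀ p : G, TangentSpace J p →ₗ[ℝ] TangentSpace J p →ₗ[ℝ] ℝ
  symm : ∀ x, ∀ X ∈ 𝓖.algebroidFiber x, ∀ Y ∈ 𝓖.algebroidFiber x,
    form (𝓖.unit x) X Y = form (𝓖.unit x) Y X
  pos : ∀ x, ∀ X ∈ 𝓖.algebroidFiber x, X ≠ 0 → 0 < form (𝓖.unit x) X X
  smooth : ContMDiffOn J.tangent 𝓘(ℝ, ℝ) ∞
    (fun v : TangentBundle J G => form v.proj v.snd v.snd) 𝓖.algebroid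

namespace AlgebroidMetric

variable [IsManifold J ∞ G] {𝓖 : LieGroupoid I M J G}

/-- The norm `|X|_{g_A}` of an element of `A`, regarded as a tangent vector to `G` at a unit. -/
def norm (g : 𝓖.AlgebroidMetric) {p : G} (X : TangentSpace J p) : ℝ :=
  Real.sqrt (g.form p X X)

/-- The norm of the velocity `γ'(τ)` of a curve in a source fibre for the right-invariant metric:
with `a = γ τ`, it is the `g_A`-norm of `dR_{a⁻¹} (γ'(τ))`, the velocity at time `τ` of the
curve `σ ↦ γ(σ) a⁻¹`, which passes through the unit `a a⁻¹` at time `τ`. -/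
def speed (g : 𝓖.AlgebroidMetric) (γ : ℝ → G) (τ : ℝ) : ℝ :=
  g.norm (mfderivWithin 𝓘(ℝ, ℝ) J (fun σ : ℝ => 𝓖.mul (γ σ) (𝓖.inv (γ τ))) (Icc 0 1) τ (1 : ℝ))

/-- The length of a curve, parametrised by `[0,1]`, in a source fibre. -/
def length (g : 𝓖.AlgebroidMetric) (γ : ℝ → G) : ℝ≥0∞ :=
  ∫⁻ τ in Icc (0 : ℝ) 1, ENNReal.ofReal (g.speed γ τ)

/-- The Riemannian distance in the source fibre of `a` for the right-invariant metric: the infimum of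
the lengths of the `C¹` curves from `a` to `b` in this fibre, in `[0,∞]`. -/
def fiberEDist (g : 𝓖.AlgebroidMetric) (a b : G) : ℝ≥0∞ :=
  ⨅ (γ : ℝ → G) (_ : ContMDiffOn 𝓘(ℝ, ℝ) J 1 γ (Icc 0 1))
    (_ : ∀ τ ∈ Icc (0 : ℝ) 1, 𝓖.src (γ τ) = 𝓖.src a) (_ : γ 0 = a) (_ : γ 1 = b), g.length γ

/-- The Riemannian distance in a source fibre, as a real number. -/
def fiberDist (g : 𝓖.AlgebroidMetric) (a b : G) : ℝ := (g.fiberEDist a b).toReal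

end AlgebroidMetric

/-- Along a map `ι : P → M`, the subspaces `B_{ι p} ⊆ T_{unit (ι p)} G` form a smooth vector bundle of
constant rank: they are locally spanned by smooth frames. -/
def IsSubbundleAlong [IsManifold J ∞ G] (𝓖 : LieGroupoid I M J G)
    {E' : Type*} [NormedAddCommGroup E'] [NormedSpace ℝ E']
    {H' : Type*} [TopologicalSpace H'] (I' : ModelWithCorners ℝ E' H')
    {P : Type*} [TopologicalSpace P] [ChartedSpace H' P] (ι : P → M)
    (B : ∀ x : M, Submodule ℝ (TangentSpace J (𝓖.unit x))) : Prop :=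
  ∃ m : ℕ, ∀ p₀ : P, ∃ U : Set P, IsOpen U ∧ p₀ ∈ U ∧
    ∃ e : Fin m → ∀ p : P, TangentSpace J (𝓖.unit (ι p)),
      (∀ i, ContMDiffOn I' J.tangent ∞
        (fun p => (⟨𝓖.unit (ι p), e i p⟩ : TangentBundle J G)) U) ∧
      ∀ p ∈ U, LinearIndependent ℝ (fun i => e i p) ∧
        Submodule.span ℝ (range fun i => e i p) = B (ι p)

/-- The structure of a boundary groupoid (with connected leaves and connected isotropy groups) on a
Lie groupoid `G ⇉ M`. -/
structure BoundaryStructure [IsManifold J ∞ G] (𝓖 : LieGroupoid I M J G) where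
  /-- The leaves are `M_0, …, M_r`. -/
  r : ℕ
  /-- The dimensions of the leaves. -/
  dim : Fin (r + 1) → ℕ
  dim_zero : dim 0 = Module.finrank ℝ E
  dim_strictAnti : StrictAnti dim
  /-- The `k`-th leaf as a manifold, injectively immersed into `M`. -/
  Leaf : Fin (r + 1) → Type uM
  [leafTopology : ∀ k, TopologicalSpace (Leaf k)]
  [leafCharted : ∀ k, ChartedSpace (EuclideanSpace ℝ (Fin (dim k))) (Leaf k)]
  [leafManifold : ∀ k, IsManifold (𝓡 (dim k)) ∞ (Leaf k)]
  [leafT2 : ∀ k, T2Space (Leaf k)]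
  [leafSecondCountable : ∀ k, SecondCountableTopology (Leaf k)]
  [leafConnected : ∀ k, ConnectedSpace (Leaf k)]
  incl : ∀ k, Leaf k → M
  incl_injective : ∀ k, Function.Injective (incl k)
  incl_isImmersion : ∀ k, Manifold.IsImmersion (𝓡 (dim k)) I ∞ (incl k)
  /-- The `M_k` are integral manifolds of the image of the anchor, ... -/
  range_mfderiv_incl : ∀ k (p : Leaf k),
    LinearMap.range (mfderiv (𝓡 (dim k)) I (incl k) p).toLinearMap =
      (𝓖.algebroidFiber (incl k p)).map (𝓖.anchor (incl k p)).toLinearMap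
  /-- ... they are leaves, ... -/
  range_incl : ∀ k (p : Leaf k), range (incl k) = {y | 𝓖.SameLeaf (incl k p) y}
  /-- ... and there are no other leaves. -/
  exists_leaf : ∀ x : M, ∃ k, x ∈ range (incl k)
  /-- `M_k ∪ ⋯ ∪ M_r` is closed ... -/
  isClosed_closure : ∀ k, IsClosed (⋃ j ≥ k, range (incl j))
  /-- ... and an immersed submanifold (possibly with boundary or corners) of dimension `dim M_k`. -/
  Closure : Fin (r + 1) → Type uM
  ClosureModel : Fin (r + 1) → Type uH
  [closureModelTopology : ∀ k, TopologicalSpace (ClosureModel k)]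
  closureI : ∀ k, ModelWithCorners ℝ (EuclideanSpace ℝ (Fin (dim k))) (ClosureModel k)
  [closureTopology : ∀ k, TopologicalSpace (Closure k)]
  [closureCharted : ∀ k, ChartedSpace (ClosureModel k) (Closure k)]
  [closureManifold : ∀ k, IsManifold (closureI k) ∞ (Closure k)]
  [closureT2 : ∀ k, T2Space (Closure k)]
  [closureSecondCountable : ∀ k, SecondCountableTopology (Closure k)]
  closureIncl : ∀ k, Closure k → M
  closureIncl_isImmersion : ∀ k, Manifold.IsImmersion (closureI k) I ∞ (closureIncl k)
  range_closureIncl : ∀ k, range (closureIncl k) = ⋃ j ≥ k, range (incl j)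
  /-- `src⁻¹(M_k) = tgt⁻¹(M_k)`. -/
  src_preimage : ∀ k, 𝓖.src ⁻¹' range (incl k) = 𝓖.tgt ⁻¹' range (incl k)
  /-- The Lie groups `G_k`. -/
  Isotropy : Fin (r + 1) → Type uG
  isotropyDim : Fin (r + 1) → ℕ
  [isotropyTopology : ∀ k, TopologicalSpace (Isotropy k)]
  [isotropyCharted : ∀ k, ChartedSpace (EuclideanSpace ℝ (Fin (isotropyDim k))) (Isotropy k)]
  [isotropyGroup : ∀ k, Group (Isotropy k)]
  [isotropyLieGroup : ∀ k, LieGroup (𝓡 (isotropyDim k)) ∞ (Isotropy k)]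
  [isotropyT2 : ∀ k, T2Space (Isotropy k)]
  [isotropySecondCountable : ∀ k, SecondCountableTopology (Isotropy k)]
  [isotropyConnected : ∀ k, ConnectedSpace (Isotropy k)]
  isotropy_zero : Subsingleton (Isotropy 0)
  /-- The isomorphism `G_k × (M_k × M_k) ≅ src⁻¹(M_k)` of Lie groupoids over `M_k`. -/
  iso : ∀ k, Isotropy k × (Leaf k × Leaf k) → G
  tgt_iso : ∀ k h x y, 𝓖.tgt (iso k (h, (x, y))) = incl k x
  src_iso : ∀ k h x y, 𝓖.src (iso k (h, (x, y))) = incl k y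
  iso_mul : ∀ k h h' x y z,
    𝓖.mul (iso k (h, (x, y))) (iso k (h', (y, z))) = iso k (h * h', (x, z))
  /-- It is a diffeomorphism onto `src⁻¹(M_k)`, the latter with its structure of an immersed
  submanifold of `G`, i.e. as the embedded submanifold `{(a, y) | src a = y}` of `G × M_k`. -/
  iso_isSmoothEmbedding : ∀ k, Manifold.IsSmoothEmbedding
    ((𝓡 (isotropyDim k)).prod ((𝓡 (dim k)).prod (𝓡 (dim k)))) (J.prod (𝓡 (dim k))) ∞
    (fun q : Isotropy k × (Leaf k × Leaf k) => (iso k q, q.2.2))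
  range_iso : ∀ k, range (fun q : Isotropy k × (Leaf k × Leaf k) => (iso k q, q.2.2)) =
    {z : G × Leaf k | 𝓖.src z.1 = incl k z.2}
  /-- There are subbundles of `A` over `M_k ∪ ⋯ ∪ M_r` that equal the kernel of the anchor over
  `M_k`. -/
  exists_subbundle : ∀ k, ∃ B : ∀ x : M, Submodule ℝ (TangentSpace J (𝓖.unit x)),
    (∀ x, B x ≤ 𝓖.algebroidFiber x) ∧
    𝓖.IsSubbundleAlong (closureI k) (closureIncl k) B ∧
    ∀ x ∈ range (incl k),
      B x = 𝓖.algebroidFiber x ⊓ LinearMap.ker (𝓖.anchor x).toLinearMap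

/-- `M̄_k = M_k ∪ ⋯ ∪ M_r`. -/
def BoundaryStructure.leafClosure [IsManifold J ∞ G] {𝓖 : LieGroupoid I M J G}
    (S : 𝓖.BoundaryStructure) (k : Fin (S.r + 1)) : Set M :=
  ⋃ j ≥ k, range (S.incl j)

end LieGroupoid

/-- The Riemannian distance from a point to a subset of a Riemannian manifold. -/
def riemannianInfDist
    {E : Type*} [NormedAddCommGroup E] [NormedSpace ℝ E]
    {H : Type*} [TopologicalSpace H] (I : ModelWithCorners ℝ E H)
    {M : Type*} [TopologicalSpace M] [ChartedSpace H M]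
    [RiemannianBundle (fun x : M => TangentSpace I x)] (x : M) (s : Set M) : ℝ :=
  (⨅ y ∈ s, Manifold.riemannianEDist I x y).toReal

end

/-! On a source fibre over the complement of `M̄_k` consider `log (ρ ∘ tgt)`. Right translation by
`a⁻¹` is isometric by definition of the fibre metric and leaves `tgt` unchanged, so it turns the
derivative of `tgt` at `a` into the anchor at `tgt a`. The hypothesis on `dρ ∘ ν` then bounds the
derivative of `log (ρ ∘ tgt)` along a curve by `w` times its speed (`hasDerivWithinAt_comp_tgt`).
Integrating gives the estimate for each curve (`enorm_log_div_le`), and the infimum over curves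
gives it for the distance. Since `M̄_k` is a union of leaves, each saturated, `tgt` maps a source
fibre either into `M̄_k` or into its complement (`src_mem_leafClosure_iff`). The distance is finite
because a source fibre is parametrised by `G_j × M_j`, a product of connected manifolds
(`exists_curve`), and a `C¹` curve on a compact interval has finite length (`length_ne_top`). -/

noncomputable section

/-! ### Curves in manifolds and continuity of their velocities -/

/-- Any two points of a connected boundaryless manifold are joined by a `C^n` curve defined on `ℝ`
which is constant on `(-∞, 0]` and on `[1, ∞)`. -/
theorem exists_contMDiff_curve
    {E : Type*} [NormedAddCommGroup E] [NormedSpace ℝ E]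
    {H : Type*} [TopologicalSpace H] (I : ModelWithCorners ℝ E H) [I.Boundaryless]
    {X : Type*} [TopologicalSpace X] [ChartedSpace H X] (n : ℕ∞) [IsManifold I n X]
    [PreconnectedSpace X] (x y : X) :
    ∃ γ : ℝ → X, ContMDiff 𝓘(ℝ, ℝ) I n γ ∧ (∀ t ≤ 0, γ t = x) ∧ ∀ t, 1 ≤ t → γ t = y := by
  have affine (c d : ℝ) : ContMDiff 𝓘(ℝ, ℝ) 𝓘(ℝ, ℝ) n (fun t : ℝ => c * t + d) :=
    ContDiff.contMDiff (by fun_prop)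
  let P : X → X → Prop := fun x y =>
    ∃ γ : ℝ → X, ContMDiff 𝓘(ℝ, ℝ) I n γ ∧ (∀ t ≤ 0, γ t = x) ∧ ∀ t, 1 ≤ t → γ t = y
  have hsymm : Std.Symm P := by
    refine ⟨fun x y ⟨γ, hγ, h0, h1⟩ => ⟨fun t => γ (-1 * t + 1), hγ.comp (affine (-1) 1), ?_, ?_⟩⟩
    · exact fun t ht => h1 _ (by linarith)
    · exact fun t ht => h0 _ (by linarith)
  have htrans : IsTrans X P := by
    -- At speed 4 the first curve stops at `t = 1/4` and the second leaves at `t = 3/4`. Both are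
    -- constant in between, so the gluing at `1/2` is smooth.
    refine ⟨fun x y z ⟨γ, hγ, h0, h1⟩ ⟨δ, hδ, k0, k1⟩ =>
      ⟨fun t => if t ≤ 1 / 2 then γ (4 * t + 0) else δ (4 * t + (-3)), fun t => ?_, ?_, ?_⟩⟩
    · rcases lt_or_ge t (1 / 2) with ht | ht
      · refine ((hγ.comp (affine 4 0)) t).congr_of_eventuallyEq ?_
        filter_upwards [Iio_mem_nhds ht] with s hs
        have hs : s < 1 / 2 := hs
        simp only [Function.comp, if_pos hs.le]
      · refine ((hδ.comp (affine 4 (-3))) t).congr_of_eventuallyEq ?_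
        filter_upwards [Ioi_mem_nhds (show (1 / 4 : ℝ) < t by linarith)] with s hs
        have hs : 1 / 4 < s := hs
        by_cases h : s ≤ 1 / 2
        · simp only [Function.comp, if_pos h]
          rw [h1 _ (by linarith), k0 _ (by linarith)]
        · simp only [Function.comp, if_neg h]
    · intro t ht
      simp only [if_pos (show t ≤ 1 / 2 by linarith)]
      exact h0 _ (by linarith)
    · intro t ht
      simp only [if_neg (show ¬ t ≤ 1 / 2 by linarith)]
      exact k1 _ (by linarith)
  refine PreconnectedSpace.induction₂ P (fun x => ?_) htrans x y
  -- Local step: without boundary the chart target contains a ball around the image of `x`. A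
  -- segment in it, reparametrised by `Real.smoothTransition`, is constant outside `[0,1]`.
  obtain ⟨r, hr, hball⟩ := Metric.isOpen_iff.1 (isOpen_extChartAt_target (I := I) x) _
    (mem_extChartAt_target x)
  filter_upwards [extChartAt_source_mem_nhds (I := I) x,
    (continuousAt_extChartAt (I := I) x).preimage_mem_nhds (Metric.ball_mem_nhds _ hr)] with y hy hyr
  have hmem (t : ℝ) : extChartAt I x x + Real.smoothTransition t •
      (extChartAt I x y - extChartAt I x x) ∈ (extChartAt I x).target :=
    hball ((convex_ball _ _).add_smul_sub_mem (Metric.mem_ball_self hr) hyr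
      ⟨Real.smoothTransition.nonneg t, Real.smoothTransition.le_one t⟩)
  refine ⟨fun t => (extChartAt I x).symm (extChartAt I x x + Real.smoothTransition t •
      (extChartAt I x y - extChartAt I x x)), ?_, ?_, ?_⟩
  · refine (contMDiffOn_extChartAt_symm x).comp_contMDiff ?_ hmem
    exact (contDiff_const.add (Real.smoothTransition.contDiff.smul contDiff_const)).contMDiff
  · intro t ht
    simp [Real.smoothTransition.zero_of_nonpos ht]
  · intro t ht
    simp only [Real.smoothTransition.one_of_one_le ht, one_smul, add_sub_cancel,
      (extChartAt I x).left_inv hy]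

/-- The velocity of the first variable of a `C¹` map on a square depends continuously on the point
of the diagonal. -/
theorem continuousOn_velocity_diagonal
    {F : Type*} [NormedAddCommGroup F] [NormedSpace ℝ F]
    {K : Type*} [TopologicalSpace K] {J : ModelWithCorners ℝ F K}
    {G : Type*} [TopologicalSpace G] [ChartedSpace K G] [IsManifold J 1 G]
    {s : Set ℝ} (hs : UniqueDiffOn ℝ s)
    {Φ : ℝ × ℝ → G} (hΦ : ContMDiffOn 𝓘(ℝ, ℝ × ℝ) J 1 Φ (s ×ˢ s)) :
    ContinuousOn (fun τ : ℝ => (⟨Φ (τ, τ), mfderivWithin 𝓘(ℝ, ℝ) J (fun σ => Φ (σ, τ)) s τ (1 : ℝ)⟩ :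
      TangentBundle J G)) s := by
  have hu : UniqueMDiffOn 𝓘(ℝ, ℝ × ℝ) (s ×ˢ s) := (hs.prod hs).uniqueMDiffOn
  have h1 := hΦ.continuousOn_tangentMapWithin le_rfl hu
  -- The velocity sought is the image of the vector `(1, 0)` at `(τ, τ)` under the tangent map of
  -- `Φ`, which is continuous.
  let v : ℝ → TangentBundle 𝓘(ℝ, ℝ × ℝ) (ℝ × ℝ) := fun τ => ⟨(τ, τ), ((1 : ℝ), (0 : ℝ))⟩
  have hv : Continuous v :=
    (tangentBundleModelSpaceHomeomorph 𝓘(ℝ, ℝ × ℝ)).symm.continuous.comp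
      (show Continuous fun τ : ℝ => (((τ, τ), ((1 : ℝ), (0 : ℝ))) : (ℝ × ℝ) × (ℝ × ℝ)) by fun_prop)
  refine (h1.comp hv.continuousOn fun τ hτ => ?_).congr fun τ hτ => ?_
  · exact ⟨hτ, hτ⟩
  · have hf : HasFDerivAt (fun σ : ℝ => (σ, τ))
        ((ContinuousLinearMap.id ℝ ℝ).prod (0 : ℝ →L[ℝ] ℝ)) τ :=
      (hasFDerivAt_id τ).prodMk (hasFDerivAt_const τ τ)
    have hc := mfderivWithin_comp (I := 𝓘(ℝ, ℝ)) (I' := 𝓘(ℝ, ℝ × ℝ)) (I'' := J) (s := s)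
      (u := s ×ˢ s) (g := Φ) (f := fun σ : ℝ => (σ, τ)) τ
      ((hΦ (τ, τ) ⟨hτ, hτ⟩).mdifferentiableWithinAt one_ne_zero)
      hf.hasMFDerivAt.mdifferentiableAt.mdifferentiableWithinAt
      (fun σ hσ => ⟨hσ, hτ⟩) (hs τ hτ).uniqueMDiffWithinAt
    have hd : mfderivWithin 𝓘(ℝ, ℝ) 𝓘(ℝ, ℝ × ℝ) (fun σ : ℝ => (σ, τ)) s τ =
        (ContinuousLinearMap.id ℝ ℝ).prod (0 : ℝ →L[ℝ] ℝ) :=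
      hf.hasMFDerivAt.hasMFDerivWithinAt.mfderivWithin (hs τ hτ).uniqueMDiffWithinAt
    change (⟨Φ (τ, τ), mfderivWithin 𝓘(ℝ, ℝ) J (Φ ∘ fun σ => (σ, τ)) s τ (1 : ℝ)⟩ :
      TangentBundle J G) = _
    rw [hc, hd]
    rfl

/-! ### Right translation of curves in a source fibre to the units -/

namespace LieGroupoid

variable {E : Type uE} [NormedAddCommGroup E] [NormedSpace ℝ E]
  {H : Type uH} [TopologicalSpace H] {I : ModelWithCorners ℝ E H}
  {M : Type uM} [TopologicalSpace M] [ChartedSpace H M]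
  {F : Type uF} [NormedAddCommGroup F] [NormedSpace ℝ F]
  {K : Type uK} [TopologicalSpace K] {J : ModelWithCorners ℝ F K}
  {G : Type uG} [TopologicalSpace G] [ChartedSpace K G]

/-- The curve `σ ↦ γ(σ) γ(τ)⁻¹`, jointly in `σ` and `τ`. -/
theorem contMDiffOn_mul_inv (𝓖 : LieGroupoid I M J G) {γ : ℝ → G} {s : Set ℝ} {n : ℕ∞}
    (hγ : ContMDiffOn 𝓘(ℝ, ℝ) J n γ s) {x : M} (hsrc : ∀ τ ∈ s, 𝓖.src (γ τ) = x) :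
    ContMDiffOn 𝓘(ℝ, ℝ × ℝ) J n (fun p : ℝ × ℝ => 𝓖.mul (γ p.1) (𝓖.inv (γ p.2))) (s ×ˢ s) := by
  have h1 : ContMDiffOn 𝓘(ℝ, ℝ × ℝ) J n (fun p : ℝ × ℝ => γ p.1) (s ×ˢ s) :=
    hγ.comp contDiff_fst.contMDiff.contMDiffOn fun p hp => hp.1
  have h2 : ContMDiffOn 𝓘(ℝ, ℝ × ℝ) J n (fun p : ℝ × ℝ => 𝓖.inv (γ p.2)) (s ×ˢ s) :=
    (𝓖.contMDiff_inv.of_le (mod_cast le_top)).comp_contMDiffOn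
      (hγ.comp contDiff_snd.contMDiff.contMDiffOn fun p hp => hp.2)
  refine (𝓖.contMDiffOn_mul.of_le (mod_cast le_top)).comp (h1.prodMk h2) fun p hp => ?_
  change 𝓖.src (γ p.1) = 𝓖.tgt (𝓖.inv (γ p.2))
  rw [𝓖.tgt_inv, hsrc _ hp.1, hsrc _ hp.2]

/-- The right translate to the units of the velocity at time `τ` of a curve in a source fibre,
as an element of the fibre of `TG` at `unit (tgt (γ τ))`. -/
def velocity (𝓖 : LieGroupoid I M J G) (γ : ℝ → G) (τ : ℝ) :
    TangentSpace J (𝓖.unit (𝓖.tgt (γ τ))) :=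
  (mfderivWithin 𝓘(ℝ, ℝ) J (fun σ : ℝ => 𝓖.mul (γ σ) (𝓖.inv (γ τ))) (Icc 0 1) τ : ℝ →L[ℝ] F) 1

theorem uniqueMDiffWithinAt_unitInterval {τ : ℝ} (hτ : τ ∈ Icc (0 : ℝ) 1) :
    UniqueMDiffWithinAt 𝓘(ℝ, ℝ) (Icc (0 : ℝ) 1) τ :=
  (uniqueDiffOn_Icc zero_lt_one τ hτ).uniqueMDiffWithinAt

theorem mdifferentiableWithinAt_mul_inv (𝓖 : LieGroupoid I M J G) {γ : ℝ → G}
    (hγ : ContMDiffOn 𝓘(ℝ, ℝ) J 1 γ (Icc 0 1)) {x : M}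
    (hsrc : ∀ τ ∈ Icc (0 : ℝ) 1, 𝓖.src (γ τ) = x) {τ : ℝ} (hτ : τ ∈ Icc (0 : ℝ) 1) :
    MDifferentiableWithinAt 𝓘(ℝ, ℝ) J (fun σ : ℝ => 𝓖.mul (γ σ) (𝓖.inv (γ τ))) (Icc 0 1) τ := by
  have h : ContMDiffOn 𝓘(ℝ, ℝ) J 1 (fun σ : ℝ => 𝓖.mul (γ σ) (𝓖.inv (γ τ))) (Icc 0 1) :=
    (𝓖.contMDiffOn_mul_inv (n := 1) hγ hsrc).comp
      (f := fun σ : ℝ => (σ, τ))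
      (ContDiff.contMDiff (by fun_prop)).contMDiffOn fun σ hσ => ⟨hσ, hτ⟩
  exact (h τ hτ).mdifferentiableWithinAt one_ne_zero

/-- The source of `γ(σ) γ(τ)⁻¹` is `tgt (γ τ)` for every `σ`, so `d src` kills the velocity. -/
theorem velocity_mem (𝓖 : LieGroupoid I M J G) {γ : ℝ → G}
    (hγ : ContMDiffOn 𝓘(ℝ, ℝ) J 1 γ (Icc 0 1)) {x : M}
    (hsrc : ∀ τ ∈ Icc (0 : ℝ) 1, 𝓖.src (γ τ) = x) {τ : ℝ} (hτ : τ ∈ Icc (0 : ℝ) 1) :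
    𝓖.velocity γ τ ∈ 𝓖.algebroidFiber (𝓖.tgt (γ τ)) := by
  have hc := mfderiv_comp_mfderivWithin_of_eq (x := τ) (g := 𝓖.src)
    (𝓖.isSubmersion_src.contMDiff.mdifferentiable (by simp) _)
    (𝓖.mdifferentiableWithinAt_mul_inv hγ hsrc hτ) (uniqueMDiffWithinAt_unitInterval hτ)
    (𝓖.mul_inv (γ τ))
  have hconst : ∀ σ ∈ Icc (0 : ℝ) 1,
      (𝓖.src ∘ fun σ : ℝ => 𝓖.mul (γ σ) (𝓖.inv (γ τ))) σ = 𝓖.tgt (γ τ) := fun σ hσ => by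
    simp only [Function.comp]
    rw [𝓖.src_mul _ _ (by rw [𝓖.tgt_inv, hsrc σ hσ, hsrc τ hτ]), 𝓖.src_inv]
  have h0 : (mfderivWithin 𝓘(ℝ, ℝ) I (𝓖.src ∘ fun σ : ℝ => 𝓖.mul (γ σ) (𝓖.inv (γ τ)))
      (Icc 0 1) τ : ℝ →L[ℝ] E) = 0 :=
    (mfderivWithin_congr hconst (hconst τ hτ)).trans mfderivWithin_const
  exact (DFunLike.congr_fun hc (1 : ℝ)).symm.trans (DFunLike.congr_fun h0 (1 : ℝ))

/-- Here `τ` is both the point of differentiation and the parameter of the translating factor, so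
the two-variable map has to be restricted to the diagonal. -/
theorem continuousOn_velocity [IsManifold J 1 G] (𝓖 : LieGroupoid I M J G) {γ : ℝ → G}
    (hγ : ContMDiffOn 𝓘(ℝ, ℝ) J 1 γ (Icc 0 1)) {x : M}
    (hsrc : ∀ τ ∈ Icc (0 : ℝ) 1, 𝓖.src (γ τ) = x) :
    ContinuousOn (fun τ => (⟨𝓖.unit (𝓖.tgt (γ τ)), 𝓖.velocity γ τ⟩ : TangentBundle J G))
      (Icc 0 1) := by
  refine (continuousOn_velocity_diagonal (uniqueDiffOn_Icc zero_lt_one)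
    (𝓖.contMDiffOn_mul_inv (n := 1) hγ hsrc)).congr fun τ _ => ?_
  -- The base points `γ(τ) γ(τ)⁻¹` and `unit (tgt (γ τ))` are equal only by an axiom. All tangent
  -- spaces are the model space `F`, so the same vector serves at both.
  have key (p q : G) (h : p = q) (X : F) :
      (⟨q, X⟩ : TangentBundle J G) = (⟨p, X⟩ : TangentBundle J G) := by rw [h]
  exact key _ _ (𝓖.mul_inv (γ τ)) _

/-- The derivative of a function on `M` along the target of a curve in a source fibre. -/
theorem hasDerivWithinAt_comp_tgt (𝓖 : LieGroupoid I M J G) {γ : ℝ → G}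
    (hγ : ContMDiffOn 𝓘(ℝ, ℝ) J 1 γ (Icc 0 1)) {x : M}
    (hsrc : ∀ τ ∈ Icc (0 : ℝ) 1, 𝓖.src (γ τ) = x) {ρ : M → ℝ} {τ : ℝ} (hτ : τ ∈ Icc (0 : ℝ) 1)
    (hρ : MDifferentiableAt I 𝓘(ℝ, ℝ) ρ (𝓖.tgt (γ τ))) :
    HasDerivWithinAt (fun σ => ρ (𝓖.tgt (γ σ)))
      (mvfderiv I ρ (𝓖.tgt (γ τ)) (𝓖.anchor (𝓖.tgt (γ τ)) (𝓖.velocity γ τ))) (Icc 0 1) τ := by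
  have hu := uniqueMDiffWithinAt_unitInterval hτ
  have hq := 𝓖.mdifferentiableWithinAt_mul_inv hγ hsrc hτ
  have htgt : MDifferentiableAt J I 𝓖.tgt (𝓖.unit (𝓖.tgt (γ τ))) :=
    𝓖.isSubmersion_tgt.contMDiff.mdifferentiable (by simp) _
  have hρt : MDifferentiableAt J 𝓘(ℝ, ℝ) (ρ ∘ 𝓖.tgt) (𝓖.unit (𝓖.tgt (γ τ))) :=
    MDifferentiableAt.comp_of_eq _ hρ htgt (𝓖.tgt_unit _)
  have h1 := mfderiv_comp_of_eq hρ htgt (𝓖.tgt_unit (𝓖.tgt (γ τ)))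
  have h2 := mfderiv_comp_mfderivWithin_of_eq (x := τ) hρt hq hu (𝓖.mul_inv (γ τ))
  have hm : MDifferentiableWithinAt 𝓘(ℝ, ℝ) 𝓘(ℝ, ℝ)
      ((ρ ∘ 𝓖.tgt) ∘ fun σ : ℝ => 𝓖.mul (γ σ) (𝓖.inv (γ τ))) (Icc 0 1) τ :=
    MDifferentiableAt.comp_mdifferentiableWithinAt_of_eq τ hρt hq (𝓖.mul_inv (γ τ))
  have hd := (mdifferentiableWithinAt_iff_differentiableWithinAt.1 hm).hasFDerivWithinAt.hasDerivWithinAt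
  -- Right multiplication does not change the target.
  have heq : ∀ σ ∈ Icc (0 : ℝ) 1, ρ (𝓖.tgt (γ σ)) =
      ((ρ ∘ 𝓖.tgt) ∘ fun σ : ℝ => 𝓖.mul (γ σ) (𝓖.inv (γ τ))) σ := fun σ hσ => by
    simp only [Function.comp]
    rw [𝓖.tgt_mul _ _ (by rw [𝓖.tgt_inv, hsrc σ hσ, hsrc τ hτ])]
  convert! hd.congr heq (heq τ hτ) using 1
  rw [← mfderivWithin_eq_fderivWithin]
  have h3 : (mfderiv I 𝓘(ℝ, ℝ) ρ (𝓖.tgt (𝓖.unit (𝓖.tgt (γ τ)))) : E →L[ℝ] ℝ) =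
      mfderiv I 𝓘(ℝ, ℝ) ρ (𝓖.tgt (γ τ)) := by rw [𝓖.tgt_unit]
  exact (((DFunLike.congr_fun h2 (1 : ℝ)).trans (DFunLike.congr_fun h1 (𝓖.velocity γ τ))).trans
    (DFunLike.congr_fun h3 (𝓖.anchor (𝓖.tgt (γ τ)) (𝓖.velocity γ τ)))).symm

/-! ### Lengths and the logarithmic estimate along a curve -/

namespace AlgebroidMetric

variable [IsManifold J ∞ G] {𝓖 : LieGroupoid I M J G}

theorem norm_congr (g : 𝓖.AlgebroidMetric) {p q : G} (h : p = q) (X : F) :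
    g.norm (p := p) X = g.norm (p := q) X := by
  rw [h]

theorem norm_nonneg (g : 𝓖.AlgebroidMetric) {p : G} (X : TangentSpace J p) : 0 ≤ g.norm X :=
  Real.sqrt_nonneg _

theorem speed_eq_norm_velocity (g : 𝓖.AlgebroidMetric) (γ : ℝ → G) (τ : ℝ) :
    g.speed γ τ = g.norm (𝓖.velocity γ τ) :=
  g.norm_congr (𝓖.mul_inv (γ τ)) _

theorem continuousOn_speed (g : 𝓖.AlgebroidMetric) {γ : ℝ → G}
    (hγ : ContMDiffOn 𝓘(ℝ, ℝ) J 1 γ (Icc 0 1)) {x : M}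
    (hsrc : ∀ τ ∈ Icc (0 : ℝ) 1, 𝓖.src (γ τ) = x) :
    ContinuousOn (g.speed γ) (Icc 0 1) := by
  have : IsManifold J 1 G := .of_le (n := ∞) (mod_cast le_top)
  have h := g.smooth.continuousOn.comp (𝓖.continuousOn_velocity hγ hsrc)
    fun τ hτ => ⟨_, _, 𝓖.velocity_mem hγ hsrc hτ, rfl⟩
  exact h.sqrt.congr fun τ _ => g.speed_eq_norm_velocity γ τ

theorem length_ne_top (g : 𝓖.AlgebroidMetric) {γ : ℝ → G}
    (hγ : ContMDiffOn 𝓘(ℝ, ℝ) J 1 γ (Icc 0 1)) {x : M}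
    (hsrc : ∀ τ ∈ Icc (0 : ℝ) 1, 𝓖.src (γ τ) = x) : g.length γ ≠ ⊤ := by
  have h := (g.continuousOn_speed hγ hsrc).integrableOn_compact (μ := volume) isCompact_Icc
  exact (lintegral_ofReal_le_lintegral_enorm _).trans_lt h.2 |>.ne

/-- A function on `M` whose derivative along the anchor is bounded by `w` times the function changes
by a factor of at most `exp (w * length)` along the target of a curve in a source fibre. -/
theorem enorm_log_div_le (g : 𝓖.AlgebroidMetric) {γ : ℝ → G}
    (hγ : ContMDiffOn 𝓘(ℝ, ℝ) J 1 γ (Icc 0 1)) {x : M}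
    (hsrc : ∀ τ ∈ Icc (0 : ℝ) 1, 𝓖.src (γ τ) = x) {U : Set M} (hU : IsOpen U)
    (hγU : ∀ τ ∈ Icc (0 : ℝ) 1, 𝓖.tgt (γ τ) ∈ U) {ρ : M → ℝ}
    (hρ : ContMDiffOn I 𝓘(ℝ, ℝ) 1 ρ U) (hpos : ∀ y ∈ U, 0 < ρ y) {w : ℝ}
    (hw : ∀ y ∈ U, ∀ X ∈ 𝓖.algebroidFiber y,
      |mvfderiv I ρ y (𝓖.anchor y X)| ≤ w * ρ y * g.norm X) :
    ENNReal.ofReal |Real.log (ρ (𝓖.tgt (γ 1)) / ρ (𝓖.tgt (γ 0)))| ≤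
      ENNReal.ofReal w * g.length γ := by
  have hmem0 : (0 : ℝ) ∈ Icc (0 : ℝ) 1 := ⟨le_rfl, zero_le_one⟩
  have hmem1 : (1 : ℝ) ∈ Icc (0 : ℝ) 1 := ⟨zero_le_one, le_rfl⟩
  have htgt : ContMDiffOn 𝓘(ℝ, ℝ) I 1 (fun τ => 𝓖.tgt (γ τ)) (Icc 0 1) :=
    (𝓖.isSubmersion_tgt.contMDiff.of_le (mod_cast le_top)).comp_contMDiffOn hγ
  have hcomp : ContDiffOn ℝ 1 (fun τ => ρ (𝓖.tgt (γ τ))) (Icc 0 1) :=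
    contMDiffOn_iff_contDiffOn.1 (hρ.comp htgt hγU)
  have hne : ∀ τ ∈ Icc (0 : ℝ) 1, ρ (𝓖.tgt (γ τ)) ≠ 0 := fun τ hτ => (hpos _ (hγU τ hτ)).ne'
  -- The increment of `log (ρ ∘ tgt ∘ γ)` is at most the integral of the norm of its derivative. It
  -- remains to compare integrands.
  have hftc := enorm_sub_le_lintegral_derivWithin_Icc_of_contDiffOn_Icc
    (hcomp.log hne) zero_le_one
  rw [Real.log_div (hne 1 hmem1) (hne 0 hmem0), ← Real.enorm_eq_ofReal_abs]
  refine hftc.trans ?_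
  rw [length, ← lintegral_const_mul' _ _ ENNReal.ofReal_ne_top]
  refine setLIntegral_mono' measurableSet_Icc fun τ hτ => ?_
  have hd := (𝓖.hasDerivWithinAt_comp_tgt hγ hsrc hτ
    ((hρ.contMDiffAt (hU.mem_nhds (hγU τ hτ))).mdifferentiableAt one_ne_zero)).log (hne τ hτ)
  rw [hd.derivWithin (uniqueDiffOn_Icc zero_lt_one τ hτ), Real.enorm_eq_ofReal_abs,
    -- Only the speed has to be nonnegative here, so `w` may have any sign.
    ← ENNReal.ofReal_mul' (by rw [speed_eq_norm_velocity]; exact g.norm_nonneg _)]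
  refine ENNReal.ofReal_le_ofReal ?_
  have hp := hpos _ (hγU τ hτ)
  rw [abs_div, abs_of_pos hp, div_le_iff₀ hp, speed_eq_norm_velocity]
  linarith [hw _ (hγU τ hτ) _ (𝓖.velocity_mem hγ hsrc hτ)]

theorem fiberEDist_le_length (g : 𝓖.AlgebroidMetric) {γ : ℝ → G}
    (hγ : ContMDiffOn 𝓘(ℝ, ℝ) J 1 γ (Icc 0 1))
    (hsrc : ∀ τ ∈ Icc (0 : ℝ) 1, 𝓖.src (γ τ) = 𝓖.src (γ 0)) :
    g.fiberEDist (γ 0) (γ 1) ≤ g.length γ :=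
  iInf₂_le_of_le γ hγ (iInf₂_le_of_le hsrc rfl (iInf_le_of_le rfl le_rfl))

end AlgebroidMetric

/-! ### Connectedness of source fibres and saturation of `M̄_k` -/

namespace BoundaryStructure

variable [IsManifold J ∞ G] {𝓖 : LieGroupoid I M J G}

/-- Two points of a source fibre are joined by a `C¹` curve in this fibre. -/
theorem exists_curve (S : 𝓖.BoundaryStructure) {a b : G} (hab : 𝓖.src a = 𝓖.src b) :
    ∃ γ : ℝ → G, ContMDiffOn 𝓘(ℝ, ℝ) J 1 γ (Icc 0 1) ∧
      (∀ τ ∈ Icc (0 : ℝ) 1, 𝓖.src (γ τ) = 𝓖.src a) ∧ γ 0 = a ∧ γ 1 = b := by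
  obtain ⟨j, y, hy⟩ := S.exists_leaf (𝓖.src a)
  let _ := S.leafTopology j
  let _ := S.leafCharted j
  let _ := S.leafManifold j
  let _ := S.leafConnected j
  let _ := S.isotropyTopology j
  let _ := S.isotropyCharted j
  let _ := S.isotropyGroup j
  let _ := S.isotropyLieGroup j
  let _ := S.isotropyConnected j
  -- Under `iso`, both `a` and `b` have last coordinate `y`, so it suffices to join their components
  -- in `G_j` and in `M_j`.
  obtain ⟨⟨h, p, y₁⟩, h₁⟩ : (a, y) ∈ range _ := (S.range_iso j).symm.subset hy.symm
  obtain ⟨⟨h', p', y₂⟩, h₂⟩ : (b, y) ∈ range _ :=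
    (S.range_iso j).symm.subset (hab.symm.trans hy.symm)
  obtain ⟨rfl, rfl⟩ := Prod.mk.inj h₁
  obtain ⟨rfl, h₃⟩ := Prod.mk.inj h₂
  obtain rfl : y₂ = y₁ := h₃
  have hiso := (S.iso_isSmoothEmbedding j).contMDiff
  obtain ⟨η, hη, hη0, hη1⟩ := exists_contMDiff_curve (𝓡 (S.isotropyDim j)) ⊤ h h'
  obtain ⟨θ, hθ, hθ0, hθ1⟩ := exists_contMDiff_curve (𝓡 (S.dim j)) ⊤ p p'
  refine ⟨fun t => S.iso j (η t, (θ t, y₂)), ?_, ?_, ?_, ?_⟩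
  · have h := contMDiff_fst.comp (hiso.comp (hη.prodMk (hθ.prodMk (contMDiff_const (c := y₂)))))
    exact (h.of_le (mod_cast le_top)).contMDiffOn
  · intro τ _
    rw [S.src_iso, S.src_iso]
  · simp only [hη0 0 le_rfl, hθ0 0 le_rfl]
  · simp only [hη1 1 le_rfl, hθ1 1 le_rfl]

theorem src_mem_leafClosure_iff (S : 𝓖.BoundaryStructure) (k : Fin (S.r + 1)) (a : G) :
    𝓖.src a ∈ S.leafClosure k ↔ 𝓖.tgt a ∈ S.leafClosure k := by
  simp only [leafClosure, mem_iUnion]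
  exact exists_congr fun j => exists_congr fun _ => Set.ext_iff.1 (S.src_preimage j) a

end BoundaryStructure

end LieGroupoid

theorem riemannianInfDist_eq_zero
    {E : Type*} [NormedAddCommGroup E] [NormedSpace ℝ E]
    {H : Type*} [TopologicalSpace H] (I : ModelWithCorners ℝ E H)
    {M : Type*} [TopologicalSpace M] [ChartedSpace H M]
    [RiemannianBundle (fun x : M => TangentSpace I x)] {x : M} {s : Set M} (hx : x ∈ s) :
    riemannianInfDist I x s = 0 := by
  have h : ⨅ y ∈ s, Manifold.riemannianEDist I x y = 0 :=
    le_antisymm ((iInf₂_le x hx).trans Manifold.riemannianEDist_self.le) zero_le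
  rw [riemannianInfDist, h, ENNReal.toReal_zero]

end

/-! ### The distance estimate -/

theorem mainTheorem7
    {E : Type*} [NormedAddCommGroup E] [NormedSpace ℝ E] [FiniteDimensional ℝ E]
    {H : Type*} [TopologicalSpace H] {I : ModelWithCorners ℝ E H}
    {M : Type*} [TopologicalSpace M] [ChartedSpace H M] [IsManifold I ∞ M]
    [T2Space M] [SecondCountableTopology M] [CompactSpace M]
    {F : Type*} [NormedAddCommGroup F] [NormedSpace ℝ F] [FiniteDimensional ℝ F]
    {K : Type*} [TopologicalSpace K] {J : ModelWithCorners ℝ F K}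
    {G : Type*} [TopologicalSpace G] [ChartedSpace K G] [IsManifold J ∞ G]
    [T2Space G] [SecondCountableTopology G]
    -- a boundary groupoid `G ⇉ M`, a metric on its Lie algebroid, a Riemannian metric on `M`
    (𝓖 : LieGroupoid I M J G) (S : 𝓖.BoundaryStructure) (g : 𝓖.AlgebroidMetric)
    [RiemannianBundle (fun x : M => TangentSpace I x)]
    [IsContMDiffRiemannianBundle I ∞ E (fun x : M => TangentSpace I x)]
    -- a defining function of `M̄_k`
    (k : Fin (S.r + 1)) (ρ : M → ℝ)
    (hρ_smooth : ContMDiffOn I 𝓘(ℝ, ℝ) ∞ ρ (S.leafClosure k)ᶜ)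
    (hρ_pos : ∀ x ∉ S.leafClosure k, 0 < ρ x)
    (hρ_dist : ∃ U : Set M, IsOpen U ∧ S.leafClosure k ⊆ U ∧
      ∀ x ∈ U, ρ x = riemannianInfDist I x (S.leafClosure k))
    (w : ℝ)
    (hw : ∀ x ∉ S.leafClosure k, ∀ X ∈ 𝓖.algebroidFiber x,
      |mvfderiv I ρ x (𝓖.anchor x X)| ≤ w * ρ x * g.norm X)
    (x : M) (a b : G) (ha : 𝓖.src a = x) (hb : 𝓖.src b = x) :
    g.fiberEDist a b ≠ ⊤ ∧
    (x ∈ S.leafClosure k → ρ (𝓖.tgt a) = 0 ∧ ρ (𝓖.tgt b) = 0) ∧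
    (x ∉ S.leafClosure k → 0 < ρ (𝓖.tgt a) ∧ 0 < ρ (𝓖.tgt b) ∧
      |Real.log (ρ (𝓖.tgt b) / ρ (𝓖.tgt a))| ≤ w * g.fiberDist a b) := by
  subst ha
  obtain ⟨γ, hγ, hsrc, h0, h1⟩ := S.exists_curve hb.symm
  have hγ_le : g.fiberEDist a b ≤ g.length γ := by
    have := g.fiberEDist_le_length hγ (by rwa [h0])
    rwa [h0, h1] at this
  have hfin : g.fiberEDist a b ≠ ⊤ := ne_top_of_le_ne_top (g.length_ne_top hγ hsrc) hγ_le
  refine ⟨hfin, fun hx => ?_, fun hx => ?_⟩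
  · obtain ⟨U, -, hU, hd⟩ := hρ_dist
    have hzero (y : M) (hy : y ∈ S.leafClosure k) : ρ y = 0 := by
      rw [hd y (hU hy), riemannianInfDist_eq_zero I hy]
    exact ⟨hzero _ ((S.src_mem_leafClosure_iff k a).1 hx),
      hzero _ ((S.src_mem_leafClosure_iff k b).1 (hb ▸ hx))⟩
  · have htgt (c : G) (hc : 𝓖.src c = 𝓖.src a) : 𝓖.tgt c ∈ (S.leafClosure k)ᶜ := fun h =>
      hx (hc ▸ (S.src_mem_leafClosure_iff k c).2 h)
    refine ⟨hρ_pos _ (htgt a rfl), hρ_pos _ (htgt b hb), ?_⟩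
    have hbound (δ : ℝ → G) (hδ : ContMDiffOn 𝓘(ℝ, ℝ) J 1 δ (Icc 0 1))
        (hδsrc : ∀ τ ∈ Icc (0 : ℝ) 1, 𝓖.src (δ τ) = 𝓖.src a) (hδ0 : δ 0 = a) (hδ1 : δ 1 = b) :
        ENNReal.ofReal |Real.log (ρ (𝓖.tgt b) / ρ (𝓖.tgt a))| ≤
          ENNReal.ofReal w * g.length δ := by
      have := g.enorm_log_div_le hδ hδsrc (S.isClosed_closure k).isOpen_compl
        (fun τ hτ => htgt _ (hδsrc τ hτ)) (hρ_smooth.of_le (mod_cast le_top)) hρ_pos hw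
      rwa [hδ0, hδ1] at this
    rcases le_or_gt 0 w with hw0 | hw0
    · have h : ENNReal.ofReal |Real.log (ρ (𝓖.tgt b) / ρ (𝓖.tgt a))| ≤
          ENNReal.ofReal w * g.fiberEDist a b := by
        -- For `w = 0` a single curve of any length already forces the logarithm to vanish. For `w >
        -- 0` one divides by `w` and passes to the infimum over curves.
        rcases hw0.eq_or_lt with rfl | hw0
        · simpa using hbound γ hγ hsrc h0 h1
        · have hw' : ENNReal.ofReal w ≠ 0 := (ENNReal.ofReal_pos.2 hw0).ne'
          rw [← ENNReal.div_le_iff' hw' ENNReal.ofReal_ne_top]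
          refine le_iInf fun δ => le_iInf₂ fun hδ hδsrc => le_iInf₂ fun hδ0 hδ1 => ?_
          rw [ENNReal.div_le_iff' hw' ENNReal.ofReal_ne_top]
          exact hbound δ hδ hδsrc hδ0 hδ1
      have h' := ENNReal.toReal_mono (ENNReal.mul_ne_top ENNReal.ofReal_ne_top hfin) h
      rwa [ENNReal.toReal_ofReal (abs_nonneg _), ENNReal.toReal_mul,
        ENNReal.toReal_ofReal hw0] at h'
    -- For `w < 0` the bound `0 ≤ w * ρ * |X|` forces `|X| = 0`, so `γ` has length zero. Both the
    -- logarithm and the distance then vanish.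
    · have hlen : g.length γ = 0 := by
        rw [LieGroupoid.AlgebroidMetric.length, setLIntegral_congr_fun (g := fun _ => 0)
          measurableSet_Icc, lintegral_zero]
        intro τ hτ
        have hmem := htgt _ (hsrc τ hτ)
        have h := hw _ hmem _ (𝓖.velocity_mem hγ hsrc hτ)
        rw [← g.speed_eq_norm_velocity] at h
        have hneg := mul_neg_of_neg_of_pos hw0 (hρ_pos _ hmem)
        refine ENNReal.ofReal_eq_zero.2 (not_lt.1 fun hs => ?_)
        linarith [abs_nonneg (mvfderiv I ρ (𝓖.tgt (γ τ))
          (𝓖.anchor (𝓖.tgt (γ τ)) (𝓖.velocity γ τ))), mul_neg_of_neg_of_pos hneg hs]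
      have hlog := hbound γ hγ hsrc h0 h1
      rw [hlen, mul_zero, nonpos_iff_eq_zero, ENNReal.ofReal_eq_zero] at hlog
      rw [LieGroupoid.AlgebroidMetric.fiberDist, le_antisymm (hγ_le.trans hlen.le) zero_le,
        ENNReal.toReal_zero, mul_zero]
      exact hlog
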